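/- Throughout, $O(\cdot)$ refers to $N\to+\infty$, its constants may depend on $n,m,f,g$, subscripts denote partial derivatives ($h_{zz}$ is the Hessian matrix with respect to $z\in\mathbb{R}^n$), and "analytic near a set" means real-valued and real analytic on a compact neighbourhood of that set. Let $n,m\ge 0$ be integers. (a) Interior maximum. Let $D=(-1,1)^n$ and let $f,g$ be functions of $z$, analytic near $\overline D$. Assume that $z=0$ is the unique maximum point of $f$ on $\overline D$ and that $f_{zz}(0)$ is negative definite. Put $$M_g(N)=\frac{\int_D g(z)\,e^{Nf(z)}\,dz}{\int_D e^{Nf(z)}\,dz},\qquad V_g(N)=\frac{\int_D \big(g(z)-M_g(N)\big)^2e^{Nf(z)}\,dz}{\int_D e^{Nf(z)}\,dz}.$$ Then, with $G(z)=(g(z)-g(0))^2$, $$M_g(N)=g(0)+O(N^{-1}),\qquad V_g(N)=\frac{\operatorname{tr}\!\big(-G_{zz}(0)\,f_{zz}(0)^{-1}\big)}{2N}+O(N^{-2}).$$ (b) Maximum on the boundary of a half space. Let $D=(0,1)\times(-1,1)^n$ and let $f,g$ be functions of $(x,z)$, analytic near $\overline D$. Assume that $(0,0)$ is the unique maximum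 point of $f$ on $\overline D$, that $f_{zz}(0,0)$ is negative definite, and that $f_x(0,0)<0$. Put $$M_g(N)=\frac{\int_D x^m g(x,z)\,e^{Nf(x,z)}\,dx\,dz}{\int_D x^m e^{Nf(x,z)}\,dx\,dz},\qquad V_g(N)=\frac{\int_D x^m\big(g(x,z)-M_g(N)\big)^2e^{Nf(x,z)}\,dx\,dz}{\int_D x^m e^{Nf(x,z)}\,dx\,dz}.$$ Then, with $G(x,z)=(g(x,z)-g(0,0))^2$, $$M_g(N)=g(0,0)+O(N^{-1}),\qquad V_g(N)=\frac{\operatorname{tr}\!\big(-G_{zz}(0,0)\,f_{zz}(0,0)^{-1}\big)}{2N}+O(N^{-2}).$$ -/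

import Mathlib

open MeasureTheory Asymptotics Filter Set

noncomputable section

namespace BayesLaplace

/-- The open cube `(-1, 1)^n`. -/
def cube (n : ℕ) : Set (Fin n → ℝ) := Set.univ.pi fun _ => Ioo (-1) 1

/-- The half cube `(0, 1) × (-1, 1)^n`, with points written `(x, z)`. -/
def halfCube (n : ℕ) : Set (ℝ × (Fin n → ℝ)) := Ioo 0 1 ×ˢ cube n

/-- `f` is real analytic on some compact neighbourhood of the set `S`. -/
def AnalyticNear {E : Type*} [NormedAddCommGroup E] [NormedSpace ℝ E]
    (f : E → ℝ) (S : Set E) : Prop :=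
  ∃ K : Set E, IsCompact K ∧ S ⊆ interior K ∧ AnalyticOnNhd ℝ f K

/-- On the set `S`, the function `f` has a maximum at the point `a`, and nowhere else. -/
def UniqueMaxOn {E : Type*} (f : E → ℝ) (S : Set E) (a : E) : Prop :=
  a ∈ S ∧ ∀ p ∈ S, p ≠ a → f p < f a

/-- The Hessian matrix `(∂²f / ∂zᵢ∂zⱼ)` of `f` at `z`. -/
def hessian {n : ℕ} (f : (Fin n → ℝ) → ℝ) (z : Fin n → ℝ) : Matrix (Fin n) (Fin n) ℝ :=
  Matrix.of fun i j => fderiv ℝ (fderiv ℝ f) z (Pi.single i 1) (Pi.single j 1)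

/-- The Bayesian mean `M_g(N) = ∫_D w g exp(N f) / ∫_D w exp(N f)`, with weight `w`. -/
def bayesMean {E : Type*} [MeasureSpace E] (D : Set E) (w f g : E → ℝ) (N : ℝ) : ℝ :=
  (∫ p in D, w p * g p * Real.exp (N * f p)) / ∫ p in D, w p * Real.exp (N * f p)

/-- The Bayesian variance `V_g(N) = ∫_D w (g - M_g(N))² exp(N f) / ∫_D w exp(N f)`. -/
def bayesVariance {E : Type*} [MeasureSpace E] (D : Set E) (w f g : E → ℝ) (N : ℝ) : ℝ :=
  (∫ p in D, w p * (g p - bayesMean D w f g N) ^ 2 * Real.exp (N * f p)) /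
    ∫ p in D, w p * Real.exp (N * f p)

end BayesLaplace

end

/-!
Only the half-cube case needs analysis: a maximum of `f` in the interior of the cube becomes a
maximum of `f z - x` on the boundary of the half cube, and the integrals over `x` cancel in every
quotient (`bayesMean_halfCube_sub_fst`).

On the half cube no Gaussian integral is evaluated; everything comes from integration by parts
against `x ^ m * exp (N * f)`. For a `C¹` function `u` supported away from the outer faces,
the means of `∂ⱼ u + N * u * ∂ⱼ f` and of `(m + 1) * u + x * (∂ₓ u + N * u * ∂ₓ f)` vanish
(`bayesMean_tangential_eq_zero`, `bayesMean_normal_eq_zero`); the factor `x` in the second identity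
removes the boundary term at `x = 0`. So a function of the form `φ = l (gradField f)`,
where `gradField f = (x * ∂ₓ f, ∂₁ f, …, ∂ₙ f)` and `l` is a field of linear forms, has mean
`-N⁻¹` times the mean of an explicit divergence `Φ` of `l`, up to the contribution of the region
away from the origin, which is exponentially small (`exists_bayesMean_expansion`,
`bayesMean_isBigO_of_eventuallyEq_zero`).

Every `φ` that is analytic at the origin and vanishes there has this form near the origin:
`gradField f` vanishes at the origin and its derivative there is invertible, because `∂ₓ f ≠ 0` and
the tangential Hessian `H` is nondegenerate, so that writing `φ p = L p p` and
`gradField f p = A p p` (`AnalyticAt.exists_eq_clm_apply`) one can take `l = L ∘ A⁻¹`.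
Hence the mean of such a `φ` is `O(N⁻¹)`, which for `φ = g - g 0` is the first claim.

For `(g - g 0)²` the field of forms is `(g - g 0) • l`, with divergence `Φ 0 = ∑ⱼ ∂ⱼg * lⱼ` at the
origin. Differentiating `g - g 0 = l (gradField f)` at the origin gives `∇g = H l`, so
`Φ 0 = ∇g · H⁻¹ ∇g`, which is `-1/2` times the trace in the theorem. As the mean of `Φ - Φ 0` is
`O(N⁻¹)`, the mean of `(g - g 0)²` is `-Φ 0 / N + O(N⁻²)`; it differs from the variance by the
square of the first-order error, again `O(N⁻²)`.
-/

namespace BayesLaplace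

open scoped Topology

/-! ### Integration by parts on a half space -/

theorem integral_halfSpace_pow_mul_fderiv_snd {F : Type*} [NormedAddCommGroup F] [NormedSpace ℝ F]
    [FiniteDimensional ℝ F] [MeasureSpace F] [BorelSpace F] [(volume : Measure F).IsAddHaarMeasure]
    {W : ℝ × F → ℝ} (hW : ContDiff ℝ 1 W) (hc : HasCompactSupport W) (m : ℕ) (v : F) :
    ∫ p in Ioi (0 : ℝ) ×ˢ (univ : Set F), p.1 ^ m * fderiv ℝ W p (0, v) = 0 := by
  have hcont : Continuous fun p => fderiv ℝ W p (0, v) :=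
    (hW.continuous_fderiv (by simp)).clm_apply continuous_const
  have hcs : HasCompactSupport fun p => fderiv ℝ W p (0, v) := hc.fderiv_apply ℝ (0, v)
  have hint : Integrable (fun p : ℝ × F => p.1 ^ m * fderiv ℝ W p (0, v)) :=
    Continuous.integrable_of_hasCompactSupport (by fun_prop) hcs.mul_left
  rw [Measure.volume_eq_prod, setIntegral_prod _ (by
    rw [← Measure.volume_eq_prod]; exact hint.integrableOn)]
  refine integral_eq_zero_of_ae (Eventually.of_forall fun x => ?_)
  have hWx : ContDiff ℝ 1 fun z => W (x, z) := hW.comp (by fun_prop)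
  have hcx : HasCompactSupport fun z => W (x, z) :=
    hc.comp_isClosedEmbedding (.of_isEmbedding_isClosedMap (isEmbedding_prodMkRight x)
      (isClosedMap_prodMk_left x))
  have hd : ∀ z, fderiv ℝ W (x, z) (0, v) = fderiv ℝ (fun z => W (x, z)) z v := by
    intro z
    have h := ((hW.differentiable (by simp)).differentiableAt (x := (x, z))).hasFDerivAt.comp z
      (hasFDerivAt_prodMk_right x z)
    rw [HasFDerivAt.fderiv (f := fun z => W (x, z)) h]
    simp
  -- partial integration against the constant function `1`
  have h := integral_mul_fderiv_eq_neg_fderiv_mul_of_integrable (μ := (volume : Measure F)) (𝕜 := ℝ)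
    (f := fun _ : F => (1 : ℝ)) (g := fun z => W (x, z)) (v := v) (by simp) ?_ ?_
    (fun _ _ => differentiableAt_const _)
    (fun z _ => (hWx.differentiable (by simp)).differentiableAt)
  · simp only [Pi.zero_apply, hd, integral_const_mul, setIntegral_univ]
    simp at h
    rw [h, mul_zero]
  · simp only [one_mul]
    exact ((hWx.continuous_fderiv (by simp)).clm_apply
      continuous_const).integrable_of_hasCompactSupport (hcx.fderiv_apply ℝ v)
  · simpa using hWx.continuous.integrable_of_hasCompactSupport hcx

/-- The integrand is the `x`-derivative of `x ^ (m + 1) * W`, which vanishes on the boundary. -/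
theorem integral_halfSpace_pow_mul_add_fderiv_fst {F : Type*} [NormedAddCommGroup F]
    [NormedSpace ℝ F] [FiniteDimensional ℝ F] [MeasureSpace F] [BorelSpace F]
    [(volume : Measure F).IsAddHaarMeasure]
    {W : ℝ × F → ℝ} (hW : ContDiff ℝ 1 W) (hc : HasCompactSupport W) (m : ℕ) :
    ∫ p in Ioi (0 : ℝ) ×ˢ (univ : Set F),
      p.1 ^ m * ((m + 1) * W p + p.1 * fderiv ℝ W p (1, 0)) = 0 := by
  have hcont : Continuous fun p => fderiv ℝ W p (1, 0) :=
    (hW.continuous_fderiv (by simp)).clm_apply continuous_const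
  have hcs : HasCompactSupport fun p => fderiv ℝ W p (1, 0) := hc.fderiv_apply ℝ (1, 0)
  have hWc := hW.continuous
  have hint : Integrable
      (fun p : ℝ × F => p.1 ^ m * ((m + 1) * W p + p.1 * fderiv ℝ W p (1, 0))) :=
    Continuous.integrable_of_hasCompactSupport (by fun_prop)
      (hc.mul_left.add hcs.mul_left).mul_left
  rw [Measure.volume_eq_prod, ← Measure.prod_restrict, integral_prod_symm _ (by
    rw [Measure.prod_restrict, ← Measure.volume_eq_prod]; exact hint.integrableOn)]
  refine integral_eq_zero_of_ae (Eventually.of_forall fun z => ?_)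
  have hcx : HasCompactSupport fun x => W (x, z) :=
    hc.comp_isClosedEmbedding (
      .of_isEmbedding_isClosedMap (isEmbedding_prodMkLeft z)
      (isClosedMap_prodMk_right z))
  have hd : ∀ x, HasDerivAt (fun x => x ^ (m + 1) * W (x, z))
      (x ^ m * ((m + 1) * W (x, z) + x * fderiv ℝ W (x, z) (1, 0))) x := by
    intro x
    have h := ((hW.differentiable (by simp)).differentiableAt
      (x := (x, z))).hasFDerivAt.comp_hasDerivAt x ((hasDerivAt_id x).prodMk (hasDerivAt_const x z))
    refine ((hasDerivAt_pow (m + 1) x).mul h).congr_deriv ?_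
    simp only [Nat.cast_add, Nat.cast_one, Nat.add_sub_cancel, Function.comp_apply, id]
    ring
  have hcs' : HasCompactSupport fun x => x ^ (m + 1) * W (x, z) := hcx.mul_left
  have h := integral_Ioi_of_hasDerivAt_of_tendsto' (a := 0) (m := 0) (fun x _ => hd x) ?_ ?_
  · simpa using h
  · refine (Continuous.integrable_of_hasCompactSupport (by fun_prop) ?_).integrableOn
    refine (hcx.mul_left.add (HasCompactSupport.mul_left ?_)).mul_left
    exact hcs.comp_isClosedEmbedding (
      .of_isEmbedding_isClosedMap (isEmbedding_prodMkLeft z)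
      (isClosedMap_prodMk_right z))
  · rw [hasCompactSupport_iff_eventuallyEq, coclosedCompact_eq_cocompact] at hcs'
    exact tendsto_nhds_of_eventually_eq (atTop_le_cocompact hcs')

/-! ### Division of analytic germs -/

/-- Hadamard's lemma for analytic germs: the shifted power series of `ψ` sums to a field of linear
maps `L` with `ψ p = L p p`. -/
theorem _root_.AnalyticAt.exists_eq_clm_apply {E F : Type*} [NormedAddCommGroup E] [NormedSpace ℝ E]
    [NormedAddCommGroup F] [NormedSpace ℝ F] [CompleteSpace F] {ψ : E → F}
    (hψ : AnalyticAt ℝ ψ 0) (h0 : ψ 0 = 0) :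
    ∃ L : E → E →L[ℝ] F, AnalyticAt ℝ L 0 ∧ ∀ᶠ p in 𝓝 0, ψ p = L p p := by
  obtain ⟨s, r, hs⟩ := hψ
  have hrad : 0 < s.shift.radius := by
    rw [s.radius_shift]
    exact hs.r_pos.trans_le hs.r_le
  have hq := s.shift.hasFPowerSeriesOnBall hrad
  refine ⟨s.shift.sum, ⟨s.shift, _, hq⟩, ?_⟩
  filter_upwards [Metric.eball_mem_nhds (0 : E) hs.r_pos, Metric.eball_mem_nhds (0 : E) hrad]
    with p hp hp'
  have h1 := hs.hasSum hp
  have h2 := (hq.hasSum hp').mapL (ContinuousLinearMap.apply ℝ F p)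
  rw [zero_add] at h1 h2
  have h3 := (hasSum_nat_add_iff' 1).2 h1
  have h4 : s 0 (fun _ => p) = 0 := by
    rw [← h0, ← hs.coeff_zero (fun _ => p)]
  simp only [Finset.range_one, Finset.sum_singleton, h4, sub_zero] at h3
  refine h3.unique (h2.congr_fun fun k => ?_)
  have hsnoc : Fin.snoc (α := fun _ => E) (fun _ : Fin k => p) p = fun _ => p := by
    ext i
    simp [Fin.snoc]
  change _ = s (k + 1) (Fin.snoc (fun _ => p) p)
  rw [hsnoc]

theorem hasFDerivAt_clm_apply_self {E F : Type*} [NormedAddCommGroup E] [NormedSpace ℝ E]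
    [NormedAddCommGroup F] [NormedSpace ℝ F] {L : E → E →L[ℝ] F}
    (hL : DifferentiableAt ℝ L 0) : HasFDerivAt (fun p => L p p) (L 0) 0 := by
  simpa using hL.hasFDerivAt.clm_apply (hasFDerivAt_id (𝕜 := ℝ) (0 : E))

/-- The components of a local diffeomorphism `Ψ` fixing the origin generate the ideal of analytic
germs vanishing at the origin. -/
theorem _root_.AnalyticAt.exists_eq_clm_apply_of_isUnit_fderiv {E F : Type*}
    [NormedAddCommGroup E] [NormedSpace ℝ E] [CompleteSpace E]
    [NormedAddCommGroup F] [NormedSpace ℝ F] [CompleteSpace F] {φ : E → F} {Ψ : E → E}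
    (hφ : AnalyticAt ℝ φ 0) (hφ0 : φ 0 = 0) (hΨ : AnalyticAt ℝ Ψ 0) (hΨ0 : Ψ 0 = 0)
    (hunit : IsUnit (fderiv ℝ Ψ 0)) :
    ∃ l : E → E →L[ℝ] F, AnalyticAt ℝ l 0 ∧ ∀ᶠ p in 𝓝 0, φ p = l p (Ψ p) := by
  obtain ⟨L, hL, hφL⟩ := hφ.exists_eq_clm_apply hφ0
  obtain ⟨A, hA, hΨA⟩ := hΨ.exists_eq_clm_apply hΨ0
  -- by the product rule `A 0` is the derivative of `Ψ`, so `A p` is invertible for `p` near `0`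
  have hA0 : fderiv ℝ Ψ 0 = A 0 := by
    rw [Filter.EventuallyEq.fderiv_eq hΨA]
    exact (hasFDerivAt_clm_apply_self hA.differentiableAt).fderiv
  obtain ⟨u, hu⟩ := hunit
  rw [hA0] at hu
  have hev : ∀ᶠ p in 𝓝 (0 : E), IsUnit (A p) :=
    hA.continuousAt.eventually (hu ▸ Units.nhds u)
  refine ⟨fun p => (L p).comp (Ring.inverse (A p)), ?_, ?_⟩
  · have hinv : AnalyticAt ℝ (fun p => Ring.inverse (A p)) 0 :=
      AnalyticAt.comp (g := Ring.inverse) (hu ▸ analyticAt_inverse u) hA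
    exact AnalyticAt.comp₂ (h := fun q => ContinuousLinearMap.compL ℝ E E F q.1 q.2)
      ((ContinuousLinearMap.compL ℝ E E F).analyticAt_bilinear _) hL hinv
  · filter_upwards [hφL, hΨA, hev] with p h1 h2 h3
    have : Ring.inverse (A p) (A p p) = p := by
      rw [← mul_apply_eq_comp, Ring.inverse_mul_cancel _ h3]; rfl
    rw [h2, ContinuousLinearMap.comp_apply, this, h1]

/-! ### Means over the half cube and localization -/

theorem isOpen_cube (n : ℕ) : IsOpen (cube n) := isOpen_set_pi finite_univ fun _ _ => isOpen_Ioo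

theorem isOpen_halfCube (n : ℕ) : IsOpen (halfCube n) := isOpen_Ioo.prod (isOpen_cube n)

theorem closure_cube (n : ℕ) : closure (cube n) = univ.pi fun _ => Icc (-1) 1 := by
  rw [cube, closure_pi_set]
  simp only [closure_Ioo (show (-1 : ℝ) ≠ 1 by norm_num)]

theorem closure_halfCube (n : ℕ) : closure (halfCube n) = Icc 0 1 ×ˢ closure (cube n) := by
  rw [halfCube, closure_prod_eq, closure_Ioo zero_ne_one]

theorem isCompact_closure_cube (n : ℕ) : IsCompact (closure (cube n)) := by
  rw [closure_cube]
  exact isCompact_univ_pi fun _ => isCompact_Icc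

theorem isCompact_closure_halfCube (n : ℕ) : IsCompact (closure (halfCube n)) := by
  rw [closure_halfCube]
  exact isCompact_Icc.prod (isCompact_closure_cube n)

theorem zero_mem_closure_halfCube (n : ℕ) : (0 : ℝ × (Fin n → ℝ)) ∈ closure (halfCube n) := by
  rw [closure_halfCube, closure_cube]
  refine ⟨by simp, fun i _ => by simp⟩

variable {n : ℕ} {f φ ψ : ℝ × (Fin n → ℝ) → ℝ}

theorem integrableOn_halfCube (hf : ContinuousOn f (closure (halfCube n)))
    (hφ : ContinuousOn φ (closure (halfCube n))) (m : ℕ) (N : ℝ) :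
    IntegrableOn (fun p => p.1 ^ m * φ p * Real.exp (N * f p)) (halfCube n) := by
  refine (ContinuousOn.integrableOn_compact (isCompact_closure_halfCube n) ?_).mono_set
    subset_closure
  exact ((continuous_fst.pow m).continuousOn.mul hφ).mul
    (Real.continuous_exp.comp_continuousOn (continuousOn_const.mul hf))

theorem integrableOn_weight (hf : ContinuousOn f (closure (halfCube n))) (m : ℕ) (N : ℝ) :
    IntegrableOn (fun p => p.1 ^ m * Real.exp (N * f p)) (halfCube n) := by
  simpa using integrableOn_halfCube hf (continuousOn_const (c := (1 : ℝ))) m N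

theorem halfCube_weight_pos {p : ℝ × (Fin n → ℝ)} (hp : p ∈ halfCube n) (m : ℕ) (N : ℝ) :
    0 < p.1 ^ m * Real.exp (N * f p) :=
  mul_pos (pow_pos hp.1.1 m) (Real.exp_pos _)

theorem setIntegral_pos_of_isOpen {S : Set (ℝ × (Fin n → ℝ))} (hS : IsOpen S) (hne : S.Nonempty)
    {h : ℝ × (Fin n → ℝ) → ℝ} (hi : IntegrableOn h S) (hpos : ∀ p ∈ S, 0 < h p) :
    0 < ∫ p in S, h p := by
  rw [setIntegral_pos_iff_support_of_nonneg_ae ?_ hi]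
  · have hsupp : S ⊆ Function.support h := fun p hp => (hpos p hp).ne'
    rw [inter_eq_right.2 hsupp]
    exact hS.measure_pos _ hne
  · exact (ae_restrict_mem hS.measurableSet).mono fun p hp => (hpos p hp).le

theorem halfCube_nonempty (n : ℕ) : (halfCube n).Nonempty :=
  closure_nonempty_iff.1 ⟨0, zero_mem_closure_halfCube n⟩

/-- The normalizing denominator of every mean is positive, so that no quotient below is a junk
value. -/
theorem partition_pos (hf : ContinuousOn f (closure (halfCube n))) (m : ℕ) (N : ℝ) :
    0 < ∫ p in halfCube n, p.1 ^ m * Real.exp (N * f p) :=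
  setIntegral_pos_of_isOpen (isOpen_halfCube n) (halfCube_nonempty n) (integrableOn_weight hf m N)
    fun _ hp => halfCube_weight_pos hp m N

theorem bayesMean_add (hf : ContinuousOn f (closure (halfCube n)))
    (hφ : ContinuousOn φ (closure (halfCube n))) (hψ : ContinuousOn ψ (closure (halfCube n)))
    (m : ℕ) (N : ℝ) :
    bayesMean (halfCube n) (fun p => p.1 ^ m) f (fun p => φ p + ψ p) N =
      bayesMean (halfCube n) (fun p => p.1 ^ m) f φ N +
        bayesMean (halfCube n) (fun p => p.1 ^ m) f ψ N := by
  simp only [bayesMean]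
  rw [← add_div, ← integral_add (integrableOn_halfCube hf hφ m N) (integrableOn_halfCube hf hψ m N)]
  simp only [mul_add, add_mul]

theorem bayesMean_const_mul (c : ℝ) (m : ℕ) (N : ℝ) :
    bayesMean (halfCube n) (fun p => p.1 ^ m) f (fun p => c * φ p) N =
      c * bayesMean (halfCube n) (fun p => p.1 ^ m) f φ N := by
  simp only [bayesMean]
  rw [← mul_div_assoc, ← integral_const_mul]
  congr 2
  ext p
  ring

theorem bayesMean_const (hf : ContinuousOn f (closure (halfCube n))) (c : ℝ) (m : ℕ) (N : ℝ) :
    bayesMean (halfCube n) (fun p => p.1 ^ m) f (fun _ => c) N = c := by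
  rw [bayesMean, div_eq_iff (partition_pos hf m N).ne', ← integral_const_mul]
  congr 1
  ext p
  ring

theorem bayesMean_sub_const (hf : ContinuousOn f (closure (halfCube n)))
    (hφ : ContinuousOn φ (closure (halfCube n))) (c : ℝ) (m : ℕ) (N : ℝ) :
    bayesMean (halfCube n) (fun p => p.1 ^ m) f (fun p => φ p - c) N =
      bayesMean (halfCube n) (fun p => p.1 ^ m) f φ N - c := by
  simp only [sub_eq_add_neg]
  rw [bayesMean_add hf hφ continuousOn_const, bayesMean_const hf]

theorem bayesMean_sum (hf : ContinuousOn f (closure (halfCube n))) {ι : Type*} (s : Finset ι)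
    {u : ι → ℝ × (Fin n → ℝ) → ℝ} (hu : ∀ i, ContinuousOn (u i) (closure (halfCube n)))
    (m : ℕ) (N : ℝ) :
    bayesMean (halfCube n) (fun p => p.1 ^ m) f (fun p => ∑ i ∈ s, u i p) N =
      ∑ i ∈ s, bayesMean (halfCube n) (fun p => p.1 ^ m) f (u i) N := by
  classical
  induction s using Finset.induction_on with
  | empty => simpa using bayesMean_const hf 0 m N
  | insert i s hi ih =>
    simp only [Finset.sum_insert hi]
    rw [bayesMean_add hf (hu i) (continuousOn_finsetSum s fun j _ => hu j), ih]

/-- The variance as a second moment about an arbitrary centre `c`. -/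
theorem bayesVariance_eq (hf : ContinuousOn f (closure (halfCube n)))
    (hφ : ContinuousOn φ (closure (halfCube n))) (c : ℝ) (m : ℕ) (N : ℝ) :
    bayesVariance (halfCube n) (fun p => p.1 ^ m) f φ N =
      bayesMean (halfCube n) (fun p => p.1 ^ m) f (fun p => (φ p - c) ^ 2) N -
        (bayesMean (halfCube n) (fun p => p.1 ^ m) f φ N - c) ^ 2 := by
  set M := bayesMean (halfCube n) (fun p => p.1 ^ m) f φ N with hM
  have h : bayesMean (halfCube n) (fun p => p.1 ^ m) f (fun p => (φ p - c) ^ 2) N =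
      bayesMean (halfCube n) (fun p => p.1 ^ m) f
        (fun p => (φ p - M) ^ 2 + (2 * (M - c) * (φ p - M) + (M - c) ^ 2)) N := by
    congr 1
    ext p
    ring
  have hφM : ContinuousOn (fun p => φ p - M) (closure (halfCube n)) := hφ.sub continuousOn_const
  rw [h, bayesMean_add (φ := fun p => (φ p - M) ^ 2)
      (ψ := fun p => 2 * (M - c) * (φ p - M) + (M - c) ^ 2) hf (hφM.pow 2)
      ((continuousOn_const.mul hφM).add continuousOn_const),
    bayesMean_add (φ := fun p => 2 * (M - c) * (φ p - M)) (ψ := fun _ => (M - c) ^ 2) hf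
      (continuousOn_const.mul hφM) continuousOn_const, bayesMean_const_mul,
    bayesMean_sub_const hf hφ, bayesMean_const hf, ← hM]
  simp only [bayesVariance, bayesMean, M]
  ring

theorem abs_integral_le {C : ℝ} {w : ℝ × (Fin n → ℝ) → ℝ} {s : Set (ℝ × (Fin n → ℝ))}
    (hs : MeasurableSet s) (hw : IntegrableOn w s) (h : ∀ p ∈ s, |ψ p| ≤ C * w p) :
    |∫ p in s, ψ p| ≤ C * ∫ p in s, w p := by
  rw [← integral_const_mul, ← Real.norm_eq_abs]
  exact norm_integral_le_of_norm_le (hw.const_mul C)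
    ((ae_restrict_mem hs).mono fun p hp => by simpa using h p hp)

theorem bayesMean_isBigO_one (hf : ContinuousOn f (closure (halfCube n)))
    (hφ : ContinuousOn φ (closure (halfCube n))) (m : ℕ) :
    (fun N : ℝ => bayesMean (halfCube n) (fun p => p.1 ^ m) f φ N) =O[atTop] fun _ => (1 : ℝ) := by
  obtain ⟨C, hC⟩ := (isCompact_closure_halfCube n).exists_bound_of_continuousOn hφ
  refine IsBigO.of_bound C (Eventually.of_forall fun N => ?_)
  rw [norm_one, mul_one, Real.norm_eq_abs, bayesMean, abs_div, abs_of_pos (partition_pos hf m N),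
    div_le_iff₀ (partition_pos hf m N)]
  refine abs_integral_le (isOpen_halfCube n).measurableSet (integrableOn_weight hf m N)
    fun p hp => ?_
  have h := mul_le_mul_of_nonneg_right (hC p (subset_closure hp))
    (halfCube_weight_pos (f := f) hp m N).le
  rw [mul_right_comm, abs_mul, abs_of_pos (halfCube_weight_pos hp m N), mul_comm]
  exact h

/-- Localization: only the germ of `φ` at the maximum matters. The true rate is exponential; the
rate `N⁻²` is the one needed. -/
theorem bayesMean_isBigO_of_eventuallyEq_zero (hf : ContinuousOn f (closure (halfCube n)))
    (hmax : UniqueMaxOn f (closure (halfCube n)) 0)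
    (hφ : ContinuousOn φ (closure (halfCube n))) (h0 : φ =ᶠ[𝓝 0] 0) (m : ℕ) :
    (fun N : ℝ => bayesMean (halfCube n) (fun p => p.1 ^ m) f φ N)
      =O[atTop] fun N => (N ^ 2)⁻¹ := by
  obtain ⟨C, hC⟩ := (isCompact_closure_halfCube n).exists_bound_of_continuousOn hφ
  obtain ⟨U, hU0, hUo, h0U⟩ := eventually_nhds_iff.1 h0
  -- off `U` the phase stays below some `M < f 0`
  obtain ⟨M, hMlt, hM⟩ : ∃ M < f 0, ∀ p ∈ closure (halfCube n) \ U, f p ≤ M := by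
    rcases (closure (halfCube n) \ U).eq_empty_or_nonempty with he | hne
    · exact ⟨f 0 - 1, by linarith, by simp [he]⟩
    · obtain ⟨q, hq, hqm⟩ := ((isCompact_closure_halfCube n).diff hUo).exists_isMaxOn hne
        (hf.mono sdiff_subset)
      refine ⟨f q, hmax.2 q hq.1 ?_, hqm⟩
      rintro rfl
      exact hq.2 h0U
  obtain ⟨M', hMM', hM'⟩ := exists_between hMlt
  -- near the origin it stays above some `M' > M`
  obtain ⟨S, hSo, h0S, hS⟩ : ∃ S : Set (ℝ × (Fin n → ℝ)), IsOpen S ∧ 0 ∈ S ∧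
      ∀ p ∈ S ∩ closure (halfCube n), M' ≤ f p := by
    have := (hf 0 (zero_mem_closure_halfCube n)).eventually (lt_mem_nhds hM')
    rw [eventually_nhdsWithin_iff, eventually_nhds_iff] at this
    obtain ⟨S, hS, hSo, h0⟩ := this
    exact ⟨S, hSo, h0, fun p hp => (hS p hp.1 hp.2).le⟩
  have hSne : (S ∩ halfCube n).Nonempty :=
    mem_closure_iff.1 (zero_mem_closure_halfCube n) S hSo h0S
  have hwint : IntegrableOn (fun p : ℝ × (Fin n → ℝ) => p.1 ^ m) (halfCube n) := by
    simpa using integrableOn_weight (continuousOn_const (c := (0 : ℝ))) m 0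
  set c := ∫ p in S ∩ halfCube n, p.1 ^ m with hc
  have hcpos : 0 < c := setIntegral_pos_of_isOpen (hSo.inter (isOpen_halfCube n)) hSne
    (hwint.mono_set inter_subset_right) fun p hp => pow_pos hp.2.1.1 m
  set I := ∫ p in halfCube n, p.1 ^ m with hI
  have hbound : ∀ N : ℝ, 0 ≤ N →
      |bayesMean (halfCube n) (fun p => p.1 ^ m) f φ N| ≤
        |C| * I / c * Real.exp (-(M' - M) * N) := by
    intro N hN
    have hnum : |∫ p in halfCube n, p.1 ^ m * φ p * Real.exp (N * f p)| ≤
        (|C| * Real.exp (N * M)) * I := by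
      refine abs_integral_le (isOpen_halfCube n).measurableSet hwint fun p hp => ?_
      by_cases hpU : p ∈ U
      · have : φ p = 0 := hU0 p hpU
        simp only [this, mul_zero, zero_mul, abs_zero]
        have := pow_pos hp.1.1 m
        positivity
      · rw [abs_mul, abs_mul, Real.abs_exp, abs_of_pos (pow_pos hp.1.1 m)]
        have h1 : |φ p| ≤ |C| := (hC p (subset_closure hp)).trans (le_abs_self C)
        have h2 : Real.exp (N * f p) ≤ Real.exp (N * M) :=
          Real.exp_le_exp.2 (mul_le_mul_of_nonneg_left (hM p ⟨subset_closure hp, hpU⟩) hN)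
        calc p.1 ^ m * |φ p| * Real.exp (N * f p)
            ≤ p.1 ^ m * |C| * Real.exp (N * M) := by
              have := pow_pos hp.1.1 m
              gcongr
          _ = _ := by ring
    have hden : Real.exp (N * M') * c ≤ ∫ p in halfCube n, p.1 ^ m * Real.exp (N * f p) := by
      calc Real.exp (N * M') * c ≤ ∫ p in S ∩ halfCube n, p.1 ^ m * Real.exp (N * f p) := by
            rw [hc, ← integral_const_mul]
            refine setIntegral_mono_on ((hwint.mono_set inter_subset_right).const_mul _)
              ((integrableOn_weight hf m N).mono_set inter_subset_right)
              (hSo.inter (isOpen_halfCube n)).measurableSet fun p hp => ?_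
            rw [mul_comm]
            have := pow_pos hp.2.1.1 m
            have := hS p ⟨hp.1, subset_closure hp.2⟩
            gcongr
        _ ≤ _ := setIntegral_mono_set (integrableOn_weight hf m N)
            ((ae_restrict_mem (isOpen_halfCube n).measurableSet).mono
              fun p hp => (halfCube_weight_pos hp m N).le)
            (Eventually.of_forall inter_subset_right)
    have hI0 : 0 ≤ (|C| * Real.exp (N * M)) * I := (abs_nonneg _).trans hnum
    rw [bayesMean, abs_div, abs_of_pos (partition_pos hf m N)]
    calc _ ≤ (|C| * Real.exp (N * M)) * I / (Real.exp (N * M') * c) := by gcongr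
      _ = _ := by
        rw [show -(M' - M) * N = N * M - N * M' by ring, Real.exp_sub]
        field_simp
  have hexp : (fun N : ℝ => Real.exp (-(M' - M) * N)) =O[atTop] fun N : ℝ => (N ^ 2)⁻¹ := by
    have := (isLittleO_exp_neg_mul_rpow_atTop (sub_pos.2 hMM') (-2)).isBigO
    refine this.congr' EventuallyEq.rfl ((eventually_ge_atTop 0).mono fun N hN => ?_)
    simp only
    rw [Real.rpow_neg hN]
    norm_num
  refine IsBigO.trans (IsBigO.of_bound (|C| * I / c) ?_) hexp
  filter_upwards [eventually_ge_atTop 0] with N hN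
  rw [Real.norm_eq_abs, Real.norm_eq_abs, Real.abs_exp]
  exact hbound N hN

/-! ### The first step of the asymptotic expansion -/

theorem contDiff_of_forall_mem_tsupport {E : Type*} [NormedAddCommGroup E] [NormedSpace ℝ E]
    {u : E → ℝ} (h : ∀ p ∈ tsupport u, ContDiffAt ℝ 1 u p) : ContDiff ℝ 1 u := by
  refine contDiff_iff_contDiffAt.2 fun p => ?_
  by_cases hp : p ∈ tsupport u
  · exact h p hp
  · exact contDiffAt_const.congr_of_eventuallyEq (notMem_tsupport_iff_eventuallyEq.1 hp)

/-- The phase `f` need only be smooth near the support of `u`. -/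
theorem contDiff_mul_exp {E : Type*} [NormedAddCommGroup E] [NormedSpace ℝ E] {u f : E → ℝ}
    (hu : ContDiff ℝ 1 u) (hf : ∀ p ∈ tsupport u, ContDiffAt ℝ 1 f p) (N : ℝ) :
    ContDiff ℝ 1 fun p => u p * Real.exp (N * f p) := by
  refine contDiff_of_forall_mem_tsupport fun p hp => ?_
  have hp' : p ∈ tsupport u := closure_mono (Function.support_mul_subset_left _ _) hp
  exact hu.contDiffAt.mul (contDiffAt_const.mul (hf p hp')).exp

theorem fderiv_mul_exp {E : Type*} [NormedAddCommGroup E] [NormedSpace ℝ E] {u f : E → ℝ}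
    (hu : ContDiff ℝ 1 u) (hf : ∀ p ∈ tsupport u, ContDiffAt ℝ 1 f p) (N : ℝ) (p v : E) :
    fderiv ℝ (fun p => u p * Real.exp (N * f p)) p v =
      (fderiv ℝ u p v + N * (u p * fderiv ℝ f p v)) * Real.exp (N * f p) := by
  by_cases hp : p ∈ tsupport u
  · have h := ((hu.differentiable (by simp)).differentiableAt (x := p)).hasFDerivAt.mul
      ((((hf p hp).differentiableAt (by simp)).hasFDerivAt.const_mul N).exp)
    rw [HasFDerivAt.fderiv (f := fun p => u p * Real.exp (N * f p)) h]
    simp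
    ring
  · have h0 : u =ᶠ[𝓝 p] 0 := notMem_tsupport_iff_eventuallyEq.1 hp
    have h1 : (fun p => u p * Real.exp (N * f p)) =ᶠ[𝓝 p] fun _ => 0 := by
      filter_upwards [h0] with q hq
      simp [hq]
    have h2 : u =ᶠ[𝓝 p] fun _ => 0 := h0
    rw [h1.fderiv_eq, h2.fderiv_eq, h0.eq_of_nhds]
    simp

variable {n : ℕ} {f φ u : ℝ × (Fin n → ℝ) → ℝ}

/-- The outer faces of the half cube are invisible to functions vanishing off
`(-∞, 1) × (-1, 1)^n`. -/
theorem setIntegral_halfCube_eq {h : ℝ × (Fin n → ℝ) → ℝ}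
    (hh : ∀ p, p ∉ Iio (1 : ℝ) ×ˢ cube n → h p = 0) :
    ∫ p in halfCube n, h p = ∫ p in Ioi (0 : ℝ) ×ˢ univ, h p := by
  refine (setIntegral_eq_of_subset_of_forall_sdiff_eq_zero
    (measurableSet_Ioi.prod MeasurableSet.univ) ?_ ?_).symm
  · exact fun p hp => ⟨hp.1.1, mem_univ _⟩
  · rintro p ⟨hp, hp'⟩
    exact hh p fun hq => hp' ⟨⟨hp.1, hq.1⟩, hq.2⟩

/-- Integration by parts in a direction `(0, v)` along the boundary `x = 0`. -/
theorem bayesMean_tangential_eq_zero (hu : ContDiff ℝ 1 u) (hc : HasCompactSupport u)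
    (hsub : tsupport u ⊆ Iio 1 ×ˢ cube n) (hf : ∀ p ∈ tsupport u, ContDiffAt ℝ 1 f p)
    (m : ℕ) (N : ℝ) (v : Fin n → ℝ) :
    bayesMean (halfCube n) (fun p => p.1 ^ m) f
      (fun p => fderiv ℝ u p (0, v) + N * (u p * fderiv ℝ f p (0, v))) N = 0 := by
  have h := integral_halfSpace_pow_mul_fderiv_snd (contDiff_mul_exp hu hf N) hc.mul_right m v
  simp only [fderiv_mul_exp hu hf N] at h
  rw [bayesMean, setIntegral_halfCube_eq, div_eq_zero_iff]
  · left
    simpa only [mul_assoc] using h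
  · intro p hp
    have hp' : p ∉ tsupport u := fun hq => hp (hsub hq)
    have h2 : u =ᶠ[𝓝 p] fun _ => 0 := notMem_tsupport_iff_eventuallyEq.1 hp'
    rw [h2.fderiv_eq, h2.eq_of_nhds]
    simp

/-- Integration by parts along the vector field `x ∂ₓ`, which is tangent to the boundary `x = 0`;
the term `(m + 1) * u` is its divergence relative to the weight `x ^ m`. -/
theorem bayesMean_normal_eq_zero (hu : ContDiff ℝ 1 u) (hc : HasCompactSupport u)
    (hsub : tsupport u ⊆ Iio 1 ×ˢ cube n) (hf : ∀ p ∈ tsupport u, ContDiffAt ℝ 1 f p)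
    (m : ℕ) (N : ℝ) :
    bayesMean (halfCube n) (fun p => p.1 ^ m) f
      (fun p => (m + 1) * u p +
        p.1 * (fderiv ℝ u p (1, 0) + N * (u p * fderiv ℝ f p (1, 0)))) N = 0 := by
  have h := integral_halfSpace_pow_mul_add_fderiv_fst (contDiff_mul_exp hu hf N) hc.mul_right m
  simp only [fderiv_mul_exp hu hf N] at h
  rw [bayesMean, setIntegral_halfCube_eq, div_eq_zero_iff]
  · left
    simpa only [mul_assoc, add_mul] using h
  · intro p hp
    have hp' : p ∉ tsupport u := fun hq => hp (hsub hq)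
    have h2 : u =ᶠ[𝓝 p] fun _ => 0 := notMem_tsupport_iff_eventuallyEq.1 hp'
    rw [h2.fderiv_eq, h2.eq_of_nhds]
    simp

theorem continuousOn_fderiv_add_mul (hu : ContDiff ℝ 1 u)
    (hfu : ∀ p ∈ tsupport u, ContDiffAt ℝ 1 f p) (hf : ContinuousOn f (closure (halfCube n)))
    (N : ℝ) (v : ℝ × (Fin n → ℝ)) :
    ContinuousOn (fun p => fderiv ℝ u p v + N * (u p * fderiv ℝ f p v))
      (closure (halfCube n)) := by
  have h1 : Continuous fun p => fderiv ℝ (fun p => u p * Real.exp (N * f p)) p v :=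
    ((contDiff_mul_exp hu hfu N).continuous_fderiv (by simp)).clm_apply continuous_const
  -- the function is a continuous derivative divided by `exp (N * f)`
  refine (h1.continuousOn.mul (hf.const_mul N).neg.rexp).congr fun p _ => ?_
  simp only [Pi.mul_apply, fderiv_mul_exp hu hfu N]
  rw [mul_assoc, ← Real.exp_add]
  simp

/-- The normal component of the gradient of `f`, multiplied by `x`, and its tangential
components. -/
noncomputable def gradField (f : ℝ × (Fin n → ℝ) → ℝ) (p : ℝ × (Fin n → ℝ)) : ℝ × (Fin n → ℝ) :=
  (p.1 * fderiv ℝ f p (1, 0), fun j => fderiv ℝ f p (0, Pi.single j 1))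

theorem clm_apply_eq_sum (l : ℝ × (Fin n → ℝ) →L[ℝ] ℝ) (a : ℝ) (v : Fin n → ℝ) :
    l (a, v) = l (1, 0) * a + ∑ j, l (0, Pi.single j 1) * v j := by
  have h : (a, v) = a • ((1, 0) : ℝ × (Fin n → ℝ)) +
      ∑ j, v j • ((0, Pi.single j 1) : ℝ × (Fin n → ℝ)) := by
    refine Prod.ext ?_ ?_
    · simp [Prod.fst_sum]
    · ext i
      simp [Prod.snd_sum, Pi.single_apply]
  rw [h]
  simp only [map_add, map_sum, map_smul, smul_eq_mul, mul_comm]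

/-- If `φ = l (gradField f)` near the maximum, then the mean of `φ` is `-N⁻¹` times the mean of `Φ`,
up to `O(N⁻²)`, where near the origin `Φ` is the divergence of the vector field with components
`x * l (1, 0)` and `l (0, eⱼ)` relative to the weight `x ^ m`. -/
theorem exists_bayesMean_expansion (hf : ContinuousOn f (closure (halfCube n)))
    (hmax : UniqueMaxOn f (closure (halfCube n)) 0) (hfa : AnalyticAt ℝ f 0)
    (hφ : ContinuousOn φ (closure (halfCube n)))
    {l : ℝ × (Fin n → ℝ) → ℝ × (Fin n → ℝ) →L[ℝ] ℝ} (hl : AnalyticAt ℝ l 0)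
    (hφl : ∀ᶠ p in 𝓝 0, φ p = l p (gradField f p)) (m : ℕ) :
    ∃ Φ : ℝ × (Fin n → ℝ) → ℝ, Continuous Φ ∧ AnalyticAt ℝ Φ 0 ∧
      Φ 0 = (m + 1) * l 0 (1, 0) +
        ∑ j, fderiv ℝ (fun p => l p (0, Pi.single j 1)) 0 (0, Pi.single j 1) ∧
      (fun N : ℝ => bayesMean (halfCube n) (fun p => p.1 ^ m) f φ N +
        N⁻¹ * bayesMean (halfCube n) (fun p => p.1 ^ m) f Φ N) =O[atTop] fun N => (N ^ 2)⁻¹ := by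
  have hbox : Iio (1 : ℝ) ×ˢ cube n ∈ 𝓝 (0 : ℝ × (Fin n → ℝ)) := by
    refine (isOpen_Iio.prod (isOpen_cube n)).mem_nhds ⟨?_, fun i _ => ?_⟩ <;> simp
  obtain ⟨ε, hε, hεs⟩ := Metric.nhds_basis_closedBall.mem_iff.1
    (inter_mem hbox (inter_mem hφl (inter_mem hfa.eventually_analyticAt hl.eventually_analyticAt)))
  let χ : ContDiffBump (0 : ℝ × (Fin n → ℝ)) := ⟨ε / 2, ε, half_pos hε, half_lt_self hε⟩
  have hχs : tsupport χ = Metric.closedBall 0 ε := χ.tsupport_eq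
  -- the cut-off components of `l`
  let α : ℝ × (Fin n → ℝ) → ℝ × (Fin n → ℝ) → ℝ := fun e p => χ p * l p e
  have hαsupp : ∀ e, tsupport (α e) ⊆ Metric.closedBall 0 ε := fun e =>
    hχs ▸ closure_mono (Function.support_mul_subset_left _ _)
  have hαc : ∀ e, HasCompactSupport (α e) := fun e => χ.hasCompactSupport.mul_right
  have hα : ∀ e, ContDiff ℝ 1 (α e) := fun e => by
    refine contDiff_of_forall_mem_tsupport fun p hp => ?_
    have hlp : AnalyticAt ℝ l p := (hεs (hαsupp e hp)).2.2.2
    exact χ.contDiff.contDiffAt.mul (hlp.contDiffAt.clm_apply contDiffAt_const)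
  have hαbox : ∀ e, tsupport (α e) ⊆ Iio 1 ×ˢ cube n := fun e p hp => (hεs (hαsupp e hp)).1
  have hαf : ∀ e, ∀ p ∈ tsupport (α e), ContDiffAt ℝ 1 f p := fun e p hp =>
    AnalyticAt.contDiffAt (hεs (hαsupp e hp)).2.2.1
  have hαev : ∀ e, α e =ᶠ[𝓝 0] fun p => l p e := fun e => by
    filter_upwards [χ.eventuallyEq_one] with p hp
    simp [α, hp]
  have hαa : ∀ e, AnalyticAt ℝ (α e) 0 := fun e =>
    AnalyticAt.congr (((ContinuousLinearMap.apply ℝ ℝ e).analyticAt _).comp hl) (hαev e).symm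
  have hαdc : ∀ e v, Continuous fun p => fderiv ℝ (α e) p v := fun e v =>
    ((hα e).continuous_fderiv (by simp)).clm_apply continuous_const
  have hαda : ∀ e v, AnalyticAt ℝ (fun p => fderiv ℝ (α e) p v) 0 := fun e v =>
    ((ContinuousLinearMap.apply ℝ ℝ v).analyticAt _).comp (hαa e).fderiv
  let Φ : ℝ × (Fin n → ℝ) → ℝ := fun p =>
    ((m + 1) * α (1, 0) p + p.1 * fderiv ℝ (α (1, 0)) p (1, 0)) +
    ∑ j, fderiv ℝ (α (0, Pi.single j 1)) p (0, Pi.single j 1)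
  have hΦc : Continuous Φ := by
    have := (hα (1, 0)).continuous
    have := hαdc (1, 0) (1, 0)
    exact ((continuous_const.mul ‹_›).add (continuous_fst.mul ‹_›)).add
      (continuous_finsetSum _ fun j _ => hαdc _ _)
  refine ⟨Φ, hΦc, ?_, ?_, ?_⟩
  · exact ((analyticAt_const.mul (hαa _)).add (analyticAt_fst.mul (hαda _ _))).add
      (Finset.analyticAt_fun_sum _ fun j _ => hαda _ _)
  · simp only [Φ, Prod.fst_zero, zero_mul, add_zero, (hαev _).fderiv_eq, (hαev _).eq_of_nhds]
  · have hχφ : ContinuousOn (fun p => χ p * φ p) (closure (halfCube n)) :=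
      χ.continuous.continuousOn.mul hφ
    have hkey : ∀ N : ℝ, bayesMean (halfCube n) (fun p => p.1 ^ m) f Φ N +
        N * bayesMean (halfCube n) (fun p => p.1 ^ m) f (fun p => χ p * φ p) N = 0 := by
      intro N
      rw [← bayesMean_const_mul, ← bayesMean_add hf hΦc.continuousOn (hχφ.const_mul N)]
      -- `Φ + N * χ * φ` is a sum of functions whose means vanish by integration by parts
      have heq : (fun p => Φ p + N * (χ p * φ p)) = fun p =>
          ((m + 1) * α (1, 0) p + p.1 * (fderiv ℝ (α (1, 0)) p (1, 0) +
            N * (α (1, 0) p * fderiv ℝ f p (1, 0)))) +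
          ∑ j, (fderiv ℝ (α (0, Pi.single j 1)) p (0, Pi.single j 1) +
            N * (α (0, Pi.single j 1) p * fderiv ℝ f p (0, Pi.single j 1))) := by
        ext p
        have hp : χ p * φ p = χ p * l p (gradField f p) := by
          by_cases hp : p ∈ Metric.closedBall (0 : ℝ × (Fin n → ℝ)) ε
          · have : φ p = l p (gradField f p) := (hεs hp).2.1
            rw [this]
          · rw [image_eq_zero_of_notMem_tsupport (f := χ) (hχs ▸ hp), zero_mul, zero_mul]
        rw [hp, gradField, clm_apply_eq_sum]
        simp only [Φ, α, Finset.sum_add_distrib, ← Finset.mul_sum, mul_assoc, mul_add]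
        ring
      have hc1 := continuousOn_fderiv_add_mul (hα (1, 0)) (hαf _) hf N (1, 0)
      have hc2 := fun j : Fin n => continuousOn_fderiv_add_mul (hα (0, Pi.single j 1)) (hαf _) hf N
        (0, Pi.single j 1)
      have hc3 : ContinuousOn (fun p => (m + 1) * α (1, 0) p + p.1 * (fderiv ℝ (α (1, 0)) p (1, 0) +
          N * (α (1, 0) p * fderiv ℝ f p (1, 0)))) (closure (halfCube n)) :=
        (continuousOn_const.mul (hα _).continuous.continuousOn).add
          (continuous_fst.continuousOn.mul hc1)
      rw [heq, bayesMean_add hf hc3 (continuousOn_finsetSum _ fun j _ => hc2 j),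
        bayesMean_sum hf _ hc2, bayesMean_normal_eq_zero (hα _) (hαc _) (hαbox _) (hαf _),
        zero_add]
      exact Finset.sum_eq_zero fun j _ =>
        bayesMean_tangential_eq_zero (hα _) (hαc _) (hαbox _) (hαf _) m N _
    have hrest : ContinuousOn (fun p => φ p + (-1) * (χ p * φ p)) (closure (halfCube n)) :=
      hφ.add (hχφ.const_mul _)
    refine (bayesMean_isBigO_of_eventuallyEq_zero hf hmax hrest ?_ m).congr' ?_ EventuallyEq.rfl
    · filter_upwards [χ.eventuallyEq_one] with p hp
      simp [hp]
    · filter_upwards [eventually_gt_atTop 0] with N hN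
      rw [bayesMean_add hf hφ (hχφ.const_mul _), bayesMean_const_mul]
      have := hkey N
      field_simp
      linarith

/-! ### Expansion of the mean and the variance on the half cube -/

variable {n : ℕ} {f g φ : ℝ × (Fin n → ℝ) → ℝ}

theorem analyticAt_gradField (hf : AnalyticAt ℝ f 0) : AnalyticAt ℝ (gradField f) 0 := by
  have h : ∀ v, AnalyticAt ℝ (fun p => fderiv ℝ f p v) 0 := fun v =>
    ((ContinuousLinearMap.apply ℝ ℝ v).analyticAt _).comp hf.fderiv
  exact (analyticAt_fst.mul (h _)).prod (AnalyticAt.pi fun j => h _)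

theorem fderiv_gradField (hf : AnalyticAt ℝ f 0) (v : ℝ × (Fin n → ℝ)) :
    fderiv ℝ (gradField f) 0 v = (v.1 * fderiv ℝ f 0 (1, 0),
      fun j => fderiv ℝ (fderiv ℝ f) 0 v (0, Pi.single j 1)) := by
  have h : ∀ w, HasFDerivAt (fun p => fderiv ℝ f p w)
      ((ContinuousLinearMap.apply ℝ ℝ w).comp (fderiv ℝ (fderiv ℝ f) 0)) 0 := fun w =>
    (ContinuousLinearMap.apply ℝ ℝ w).hasFDerivAt.comp 0 hf.fderiv.differentiableAt.hasFDerivAt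
  have h1 : HasFDerivAt (gradField f) _ 0 :=
    (hasFDerivAt_fst.mul (h (1, 0))).prodMk (hasFDerivAt_pi.2 fun j => h (0, Pi.single j 1))
  rw [h1.fderiv]
  simp [mul_comm]

theorem hessian_slice (hf : AnalyticAt ℝ f 0) (i j : Fin n) :
    hessian (fun z => f (0, z)) 0 i j =
      fderiv ℝ (fderiv ℝ f) 0 (0, Pi.single i 1) (0, Pi.single j 1) := by
  have hev : fderiv ℝ (fun z => f (0, z)) =ᶠ[𝓝 0]
      fun z => (fderiv ℝ f (0, z)).comp (ContinuousLinearMap.inr ℝ ℝ (Fin n → ℝ)) := by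
    have hc : Tendsto (fun z : Fin n → ℝ => ((0 : ℝ), z)) (𝓝 0) (𝓝 0) :=
      (Continuous.prodMk_right (0 : ℝ)).tendsto' 0 0 rfl
    filter_upwards [hc.eventually hf.eventually_analyticAt] with z hz
    exact (hz.differentiableAt.hasFDerivAt.comp z (hasFDerivAt_prodMk_right 0 z)).fderiv
  have h2 : HasFDerivAt (fderiv ℝ f) (fderiv ℝ (fderiv ℝ f) 0) ((0 : ℝ), (0 : Fin n → ℝ)) :=
    hf.fderiv.differentiableAt.hasFDerivAt
  have h3 : HasFDerivAt
      (fun z => (fderiv ℝ f (0, z)).comp (ContinuousLinearMap.inr ℝ ℝ (Fin n → ℝ)))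
      _ 0 := (h2.comp 0 (hasFDerivAt_prodMk_right (0 : ℝ) (0 : Fin n → ℝ))).clm_comp
        (hasFDerivAt_const (ContinuousLinearMap.inr ℝ ℝ (Fin n → ℝ)) 0)
  rw [hessian, Matrix.of_apply, hev.fderiv_eq, h3.fderiv]
  simp

theorem deriv_slice (hf : AnalyticAt ℝ f 0) :
    deriv (fun x : ℝ => f (x, 0)) 0 = fderiv ℝ f 0 (1, 0) := by
  have h : HasFDerivAt f (fderiv ℝ f 0) ((0 : ℝ), (0 : Fin n → ℝ)) :=
    hf.differentiableAt.hasFDerivAt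
  exact (h.comp_hasDerivAt (0 : ℝ) ((hasDerivAt_id (0 : ℝ)).prodMk (hasDerivAt_const 0 0))).deriv

/-- The tangential gradient vanishes at the origin because `z ↦ f (0, z)` has an interior maximum
there. -/
theorem gradField_zero (hf : AnalyticAt ℝ f 0) (hmax : UniqueMaxOn f (closure (halfCube n)) 0) :
    gradField f 0 = 0 := by
  have hloc : IsLocalMax (fun z => f (0, z)) (0 : Fin n → ℝ) := by
    filter_upwards [(isOpen_cube n).mem_nhds (fun i _ => by simp : (0 : Fin n → ℝ) ∈ cube n)]
      with z hz
    rcases eq_or_ne ((0 : ℝ), z) 0 with h | h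
    · simp only [h]; rfl
    · refine (hmax.2 (0, z) ?_ h).le
      rw [closure_halfCube]
      exact ⟨by simp, subset_closure hz⟩
  have h : HasFDerivAt f (fderiv ℝ f 0) ((0 : ℝ), (0 : Fin n → ℝ)) :=
    hf.differentiableAt.hasFDerivAt
  have h0 := hloc.hasFDerivAt_eq_zero (h.comp 0 (hasFDerivAt_prodMk_right (0 : ℝ) (0 : Fin n → ℝ)))
  refine Prod.ext (by simp [gradField]) (funext fun j => ?_)
  exact DFunLike.congr_fun h0 (Pi.single j 1)

theorem isUnit_fderiv_gradField (hf : AnalyticAt ℝ f 0) (hx : fderiv ℝ f 0 (1, 0) ≠ 0)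
    (hdet : IsUnit (hessian (fun z => f (0, z)) 0)) : IsUnit (fderiv ℝ (gradField f) 0) := by
  rw [ContinuousLinearMap.isUnit_iff_bijective]
  have hinj : Function.Injective (fderiv ℝ (gradField f) 0) := by
    rw [injective_iff_map_eq_zero]
    rintro ⟨x, z⟩ h
    rw [fderiv_gradField hf, Prod.mk_eq_zero] at h
    obtain ⟨h1, h2⟩ := h
    have hx0 : x = 0 := (mul_eq_zero.1 h1).resolve_right hx
    subst hx0
    have h3 : Matrix.vecMul z (hessian (fun z => f (0, z)) 0) = 0 := by
      refine Eq.trans (funext fun j => ?_) h2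
      have hz : ((0 : ℝ), z) = ∑ i, z i • ((0 : ℝ), (Pi.single i 1 : Fin n → ℝ)) := by
        refine Prod.ext (by simp [Prod.fst_sum]) ?_
        ext i
        simp [Prod.snd_sum, Pi.single_apply]
      simp only [Matrix.vecMul, dotProduct, hessian_slice hf]
      rw [hz, map_sum]
      simp only [map_smul, sum_apply, smul_apply, smul_eq_mul]
    have h4 : z = 0 := Matrix.vecMul_injective_of_isUnit hdet (h3.trans (Matrix.zero_vecMul _).symm)
    rw [h4]; rfl
  exact ⟨hinj, LinearMap.surjective_of_injective (f := (fderiv ℝ (gradField f) 0).toLinearMap) hinj⟩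

theorem bayesMean_isBigO_inv (hf : ContinuousOn f (closure (halfCube n)))
    (hmax : UniqueMaxOn f (closure (halfCube n)) 0) (hfa : AnalyticAt ℝ f 0)
    (hunit : IsUnit (fderiv ℝ (gradField f) 0))
    (hφ : ContinuousOn φ (closure (halfCube n))) (hφa : AnalyticAt ℝ φ 0) (hφ0 : φ 0 = 0) (m : ℕ) :
    (fun N : ℝ => bayesMean (halfCube n) (fun p => p.1 ^ m) f φ N) =O[atTop] fun N => N⁻¹ := by
  obtain ⟨l, hl, hφl⟩ := hφa.exists_eq_clm_apply_of_isUnit_fderiv hφ0 (analyticAt_gradField hfa)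
    (gradField_zero hfa hmax) hunit
  obtain ⟨Φ, hΦ, -, -, hexp⟩ := exists_bayesMean_expansion hf hmax hfa hφ hl hφl m
  have h1 := (isBigO_refl (fun N : ℝ => N⁻¹) atTop).mul
    (bayesMean_isBigO_one hf hΦ.continuousOn m)
  have h2 : (fun N : ℝ => (N ^ 2)⁻¹) =O[atTop] fun N => N⁻¹ := by
    refine IsBigO.of_bound 1 ?_
    filter_upwards [eventually_ge_atTop 1] with N hN
    rw [Real.norm_of_nonneg (by positivity), Real.norm_of_nonneg (by positivity), one_mul]
    exact inv_anti₀ (by positivity) (by nlinarith)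
  simp only [mul_one] at h1
  simpa using (hexp.trans h2).sub h1

theorem hessian_sub_sq {h : (Fin n → ℝ) → ℝ} (hh : AnalyticAt ℝ h 0) (i j : Fin n) :
    hessian (fun z => (h z - h 0) ^ 2) 0 i j =
      2 * fderiv ℝ h 0 (Pi.single i 1) * fderiv ℝ h 0 (Pi.single j 1) := by
  have hev : fderiv ℝ (fun z => (h z - h 0) ^ 2) =ᶠ[𝓝 0]
      fun z => (2 * (h z - h 0)) • fderiv ℝ h z := by
    filter_upwards [hh.eventually_analyticAt] with z hz
    have := (hz.differentiableAt.hasFDerivAt.sub_const (h 0)).pow 2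
    rw [HasFDerivAt.fderiv (f := fun z => (h z - h 0) ^ 2) this]
    simp
  have h3 : HasFDerivAt (fun z => (2 * (h z - h 0)) • fderiv ℝ h z) _ 0 :=
    ((hh.differentiableAt.hasFDerivAt.sub_const (h 0)).const_mul 2).smul
      hh.fderiv.differentiableAt.hasFDerivAt
  rw [hessian, Matrix.of_apply, hev.fderiv_eq, h3.fderiv]
  simp

theorem laplace_halfCube (hf : ContinuousOn f (closure (halfCube n))) (hfa : AnalyticAt ℝ f 0)
    (hg : ContinuousOn g (closure (halfCube n))) (hga : AnalyticAt ℝ g 0)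
    (hmax : UniqueMaxOn f (closure (halfCube n)) 0)
    (hpos : (-hessian (fun z => f (0, z)) 0).PosDef)
    (hx : deriv (fun x : ℝ => f (x, 0)) 0 < 0) (m : ℕ) :
    ((fun N : ℝ => bayesMean (halfCube n) (fun p => p.1 ^ m) f g N - g 0)
        =O[atTop] fun N : ℝ => N⁻¹) ∧
    ((fun N : ℝ => bayesVariance (halfCube n) (fun p => p.1 ^ m) f g N
        - Matrix.trace (-hessian (fun z => (g (0, z) - g 0) ^ 2) 0
            * (hessian (fun z => f (0, z)) 0)⁻¹) / (2 * N))
        =O[atTop] fun N : ℝ => (N ^ 2)⁻¹) := by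
  set H := hessian (fun z => f (0, z)) 0 with hH
  have hHu : IsUnit H := by simpa using hpos.isUnit
  have hunit := isUnit_fderiv_gradField hfa (deriv_slice hfa ▸ hx.ne) hHu
  have hgc : ContinuousOn (fun p => g p - g 0) (closure (halfCube n)) := hg.sub continuousOn_const
  have hgca : AnalyticAt ℝ (fun p => g p - g 0) 0 := hga.sub analyticAt_const
  have hmean : (fun N : ℝ => bayesMean (halfCube n) (fun p => p.1 ^ m) f g N - g 0)
      =O[atTop] fun N : ℝ => N⁻¹ := by
    simpa only [bayesMean_sub_const hf hg] using
      bayesMean_isBigO_inv hf hmax hfa hunit hgc hgca (sub_self _) m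
  refine ⟨hmean, ?_⟩
  obtain ⟨l, hl, hgl⟩ := hgca.exists_eq_clm_apply_of_isUnit_fderiv (sub_self _)
    (analyticAt_gradField hfa) (gradField_zero hfa hmax) hunit
  have hsq : ∀ᶠ p in 𝓝 0, (g p - g 0) ^ 2 = ((g p - g 0) • l p) (gradField f p) := by
    filter_upwards [hgl] with p hp
    rw [smul_apply, ← hp, smul_eq_mul, sq]
  obtain ⟨Φ, hΦ, hΦa, hΦ0, hexp⟩ := exists_bayesMean_expansion (φ := fun p => (g p - g 0) ^ 2)
    (l := fun p => (g p - g 0) • l p) hf hmax hfa (hgc.pow 2) (hgca.smul hl) hsq m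
  -- the tangential gradient of `g` at the origin and the tangential part of `l 0`
  set a : Fin n → ℝ := fun j => fderiv ℝ g 0 (0, Pi.single j 1) with ha
  set b : Fin n → ℝ := fun j => l 0 (0, Pi.single j 1) with hb
  have hΦab : Φ 0 = b ⬝ᵥ a := by
    rw [hΦ0, dotProduct]
    simp only [sub_self, zero_smul, zero_apply, mul_zero, zero_add]
    refine Finset.sum_congr rfl fun j _ => ?_
    have h1 : HasFDerivAt (fun p => l p (0, Pi.single j 1)) _ 0 :=
      (ContinuousLinearMap.apply ℝ ℝ ((0 : ℝ), (Pi.single j 1 : Fin n → ℝ))).hasFDerivAt.comp 0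
        hl.differentiableAt.hasFDerivAt
    have h2 := (hga.differentiableAt.hasFDerivAt.sub_const (g 0)).mul h1
    simp only [smul_apply, smul_eq_mul]
    rw [HasFDerivAt.fderiv (f := fun p => (g p - g 0) * l p (0, Pi.single j 1)) h2]
    simp [ha, hb]
  -- differentiate `g - g 0 = l (gradField f)` at the origin, where `gradField f` vanishes
  have hab : a = H.mulVec b := by
    have h1 : HasFDerivAt (fun p => l p (gradField f p)) _ 0 :=
      hl.differentiableAt.hasFDerivAt.clm_apply
        (analyticAt_gradField hfa).differentiableAt.hasFDerivAt
    have h2 : fderiv ℝ g 0 = fderiv ℝ (fun p => l p (gradField f p)) 0 := by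
      rw [← Filter.EventuallyEq.fderiv_eq (f₁ := fun p => g p - g 0) hgl, fderiv_sub_const]
    ext i
    simp only [ha, h2, h1.fderiv, gradField_zero hfa hmax]
    simp [fderiv_gradField hfa, Matrix.mulVec, dotProduct, hH, hessian_slice hfa]
    rw [clm_apply_eq_sum]
    simp [hb, mul_comm]
  have htr : Matrix.trace (-hessian (fun z => (g (0, z) - g 0) ^ 2) 0 * H⁻¹) = -2 * Φ 0 := by
    have hbH : b = H⁻¹.mulVec a := by
      rw [hab, Matrix.mulVec_mulVec,
        Matrix.nonsing_inv_mul _ ((Matrix.isUnit_iff_isUnit_det _).1 hHu), Matrix.one_mulVec]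
    have hg0 : AnalyticAt ℝ (fun z : Fin n → ℝ => g (0, z)) 0 :=
      AnalyticAt.comp (g := g) (f := fun z : Fin n → ℝ => ((0 : ℝ), z)) hga
        (analyticAt_const.prod analyticAt_id)
    have hgd : ∀ j, fderiv ℝ (fun z : Fin n → ℝ => g (0, z)) 0 (Pi.single j 1) = a j := by
      intro j
      have h : HasFDerivAt g (fderiv ℝ g 0) ((0 : ℝ), (0 : Fin n → ℝ)) :=
        hga.differentiableAt.hasFDerivAt
      have h1 := h.comp 0 (hasFDerivAt_prodMk_right (0 : ℝ) (0 : Fin n → ℝ))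
      exact DFunLike.congr_fun h1.fderiv (Pi.single j 1)
    rw [hΦab, hbH, Matrix.neg_mul, Matrix.trace_neg, Matrix.trace, dotProduct]
    simp only [Matrix.diag, Matrix.mul_apply, Matrix.mulVec, dotProduct]
    have hes : ∀ i j, hessian (fun z => (g (0, z) - g 0) ^ 2) 0 i j = 2 * a i * a j := fun i j => by
      rw [← hgd, ← hgd]
      exact hessian_sub_sq hg0 i j
    simp only [hes, Finset.sum_mul, Finset.mul_sum]
    rw [Finset.sum_comm, ← Finset.sum_neg_distrib]
    refine Finset.sum_congr rfl fun i _ => ?_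
    rw [← Finset.sum_neg_distrib]
    exact Finset.sum_congr rfl fun j _ => by ring
  have hΦmean : (fun N : ℝ => N⁻¹ * (bayesMean (halfCube n) (fun p => p.1 ^ m) f Φ N - Φ 0))
      =O[atTop] fun N : ℝ => (N ^ 2)⁻¹ := by
    have := bayesMean_isBigO_inv (φ := fun p => Φ p - Φ 0) hf hmax hfa hunit
      (hΦ.continuousOn.sub continuousOn_const)
      (hΦa.sub analyticAt_const) (sub_self (Φ 0)) m
    have h := (isBigO_refl (fun N : ℝ => N⁻¹) atTop).mul
      (by simpa only [bayesMean_sub_const hf hΦ.continuousOn] using this)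
    simpa only [← mul_inv, sq] using h
  have hmean2 := hmean.pow 2
  simp only [inv_pow] at hmean2
  refine ((hexp.sub hΦmean).sub hmean2).congr' (Eventually.of_forall fun N => ?_) EventuallyEq.rfl
  simp only [htr, bayesVariance_eq hf hg (g 0)]
  have hN2 : -2 * Φ 0 / (2 * N) = - (N⁻¹ * Φ 0) := by
    rw [neg_mul, neg_div, mul_div_mul_left _ _ two_ne_zero, div_eq_inv_mul]
  rw [hN2]
  ring

/-! ### From the half cube to the cube -/

theorem AnalyticNear.continuousOn {E : Type*} [NormedAddCommGroup E] [NormedSpace ℝ E] {f : E → ℝ}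
    {S : Set E} (h : AnalyticNear f S) : ContinuousOn f S := by
  obtain ⟨K, -, hSK, hK⟩ := h
  exact hK.continuousOn.mono (hSK.trans interior_subset)

theorem AnalyticNear.analyticAt {E : Type*} [NormedAddCommGroup E] [NormedSpace ℝ E] {f : E → ℝ}
    {S : Set E} (h : AnalyticNear f S) {a : E} (ha : a ∈ S) : AnalyticAt ℝ f a := by
  obtain ⟨K, -, hSK, hK⟩ := h
  exact hK a (interior_subset (hSK ha))

/-- With the phase `f z - x` the integrals over the half cube factorize, and the factor
`∫ exp (-N * x)` cancels in the mean. -/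
theorem bayesMean_halfCube_sub_fst (f g : (Fin n → ℝ) → ℝ) (N : ℝ) :
    bayesMean (halfCube n) (fun p => p.1 ^ 0) (fun p => f p.2 - p.1) (fun p => g p.2) N =
      bayesMean (cube n) (fun _ => 1) f g N := by
  have hsplit : ∀ h : (Fin n → ℝ) → ℝ,
      ∫ p in halfCube n, h p.2 * Real.exp (N * (f p.2 - p.1)) =
        (∫ x in Ioo (0 : ℝ) 1, Real.exp (-(N * x))) * ∫ z in cube n, h z * Real.exp (N * f z) := by
    intro h
    rw [← setIntegral_prod_mul, halfCube, Measure.volume_eq_prod]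
    congr 1
    ext p
    rw [show N * (f p.2 - p.1) = -(N * p.1) + N * f p.2 by ring, Real.exp_add]
    ring
  have hne : (∫ x in Ioo (0 : ℝ) 1, Real.exp (-(N * x))) ≠ 0 := by
    refine ne_of_gt ?_
    rw [← integral_Ioc_eq_integral_Ioo, ← intervalIntegral.integral_of_le zero_le_one]
    exact intervalIntegral.intervalIntegral_pos_of_pos
      (Continuous.intervalIntegrable (by fun_prop) _ _) (fun _ => Real.exp_pos _) zero_lt_one
  simp only [bayesMean, pow_zero, one_mul]
  have h1 := hsplit fun _ => 1
  simp only [one_mul] at h1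
  rw [hsplit g, h1, mul_div_mul_left _ _ hne]

theorem laplace_cube {f g : (Fin n → ℝ) → ℝ} (hf : ContinuousOn f (closure (cube n)))
    (hfa : AnalyticAt ℝ f 0) (hg : ContinuousOn g (closure (cube n))) (hga : AnalyticAt ℝ g 0)
    (hmax : UniqueMaxOn f (closure (cube n)) 0) (hpos : (-hessian f 0).PosDef) :
    ((fun N : ℝ => bayesMean (cube n) (fun _ => 1) f g N - g 0) =O[atTop] fun N : ℝ => N⁻¹) ∧
    ((fun N : ℝ => bayesVariance (cube n) (fun _ => 1) f g N
        - Matrix.trace (-hessian (fun z => (g z - g 0) ^ 2) 0 * (hessian f 0)⁻¹) / (2 * N))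
        =O[atTop] fun N : ℝ => (N ^ 2)⁻¹) := by
  have hsnd : MapsTo Prod.snd (closure (halfCube n)) (closure (cube n)) := by
    rw [closure_halfCube]
    exact fun p hp => hp.2
  have hmax' : UniqueMaxOn (fun p : ℝ × (Fin n → ℝ) => f p.2 - p.1) (closure (halfCube n)) 0 := by
    refine ⟨zero_mem_closure_halfCube n, fun p hp hp0 => ?_⟩
    have h1 : 0 ≤ p.1 := by
      rw [closure_halfCube] at hp
      exact hp.1.1
    simp only [Prod.snd_zero, Prod.fst_zero, sub_zero]
    rcases eq_or_ne p.2 0 with h2 | h2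
    · have : p.1 ≠ 0 := fun h => hp0 (Prod.ext h h2)
      rw [h2]
      linarith [h1.lt_of_ne' this]
    · linarith [hmax.2 p.2 (hsnd hp) h2]
  have hcomp : ∀ {h : (Fin n → ℝ) → ℝ}, AnalyticAt ℝ h 0 →
      AnalyticAt ℝ (fun p : ℝ × (Fin n → ℝ) => h p.2) 0 := fun {h} hh =>
    AnalyticAt.comp (g := h) (f := Prod.snd) hh analyticAt_snd
  have key := laplace_halfCube (f := fun p => f p.2 - p.1) (g := fun p => g p.2)
    ((hf.comp continuous_snd.continuousOn hsnd).sub continuous_fst.continuousOn)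
    ((hcomp hfa).sub analyticAt_fst) (hg.comp continuous_snd.continuousOn hsnd) (hcomp hga) hmax'
    (by simpa using hpos) (by simp) 0
  have hvar : ∀ N, bayesVariance (halfCube n) (fun p => p.1 ^ 0) (fun p => f p.2 - p.1)
      (fun p => g p.2) N = bayesVariance (cube n) (fun _ => 1) f g N := by
    intro N
    change bayesMean (halfCube n) (fun p => p.1 ^ 0) (fun p => f p.2 - p.1)
      (fun p => (g p.2 - bayesMean (halfCube n) (fun p => p.1 ^ 0) (fun p => f p.2 - p.1)
        (fun p => g p.2) N) ^ 2) N = _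
    rw [bayesMean_halfCube_sub_fst f g N]
    exact bayesMean_halfCube_sub_fst f
      (fun z => (g z - bayesMean (cube n) (fun _ => 1) f g N) ^ 2) N
  simpa only [bayesMean_halfCube_sub_fst, hvar, sub_zero, Prod.snd_zero] using key

end BayesLaplace

theorem mainTheorem4 (n : ℕ) :
    -- Interior maximum.
    (∀ f g : (Fin n → ℝ) → ℝ,
      BayesLaplace.AnalyticNear f (closure (BayesLaplace.cube n)) →
      BayesLaplace.AnalyticNear g (closure (BayesLaplace.cube n)) →
      BayesLaplace.UniqueMaxOn f (closure (BayesLaplace.cube n)) 0 →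
      (-BayesLaplace.hessian f 0).PosDef →
      ((fun N : ℝ => BayesLaplace.bayesMean (BayesLaplace.cube n) (fun _ => 1) f g N - g 0)
          =O[atTop] fun N : ℝ => N⁻¹) ∧
      ((fun N : ℝ => BayesLaplace.bayesVariance (BayesLaplace.cube n) (fun _ => 1) f g N
          - Matrix.trace (-BayesLaplace.hessian (fun z => (g z - g 0) ^ 2) 0
              * (BayesLaplace.hessian f 0)⁻¹) / (2 * N))
          =O[atTop] fun N : ℝ => (N ^ 2)⁻¹)) ∧
    -- Maximum on the boundary of the half space, with weight `x ^ m`.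
    (∀ (m : ℕ) (f g : ℝ × (Fin n → ℝ) → ℝ),
      BayesLaplace.AnalyticNear f (closure (BayesLaplace.halfCube n)) →
      BayesLaplace.AnalyticNear g (closure (BayesLaplace.halfCube n)) →
      BayesLaplace.UniqueMaxOn f (closure (BayesLaplace.halfCube n)) (0, 0) →
      (-BayesLaplace.hessian (fun z => f (0, z)) 0).PosDef →
      deriv (fun x : ℝ => f (x, 0)) 0 < 0 →
      ((fun N : ℝ => BayesLaplace.bayesMean (BayesLaplace.halfCube n) (fun p => p.1 ^ m) f g N
          - g (0, 0))
          =O[atTop] fun N : ℝ => N⁻¹) ∧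
      ((fun N : ℝ => BayesLaplace.bayesVariance (BayesLaplace.halfCube n) (fun p => p.1 ^ m) f g N
          - Matrix.trace (-BayesLaplace.hessian (fun z => (g (0, z) - g (0, 0)) ^ 2) 0
              * (BayesLaplace.hessian (fun z => f (0, z)) 0)⁻¹) / (2 * N))
          =O[atTop] fun N : ℝ => (N ^ 2)⁻¹)) := by
  refine ⟨fun f g hf hg hmax hpos => ?_, fun m f g hf hg hmax hpos hx => ?_⟩
  · exact BayesLaplace.laplace_cube hf.continuousOn (hf.analyticAt hmax.1) hg.continuousOn
      (hg.analyticAt hmax.1) hmax hpos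
  · exact BayesLaplace.laplace_halfCube hf.continuousOn (hf.analyticAt hmax.1) hg.continuousOn
      (hg.analyticAt hmax.1) hmax hpos hx m
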